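/- Let $n\ge 1$ and $N=\{1,\dots,n\}$ (the regions). Let $\sigma>1$, let $\Phi=[\phi_{ij}]$ be a real $n\times n$ matrix with $\phi_{ii}=1$ and $\phi_{ij}\in(0,1)$ for $i\neq j$ (the geographical proximity matrix), and let $\Psi=[\psi_{ij}]$ be a real $n\times n$ matrix with $\psi_{ii}=1$, $\psi_{ij}\in(0,1]$, and $\sum_{i,j}\psi_{ij}z_iz_j>0$ for every $z\in\mathbb{R}^n\setminus\{0\}$ with $\sum_i z_i=0$ (the externality matrix). For a distribution of workers $x\in X=\{x\in\mathbb{R}^n : x_i\ge 0,\ \sum_i x_i=1\}$ put $a_i(x)=\sum_j\psi_{ij}x_j$. A market wage at $x$ is a vector $w\in[0,\infty]^n$ with $$w_ix_i=\sum_{k\in N}\frac{a_i^{\sigma-1}w_i^{1-\sigma}\phi_{ik}}{\sum_{l\in N}a_l^{\sigma-1}w_l^{1-\sigma}\phi_{lk}}\,w_kx_k\quad(i\in N),\qquad \sum_{i\in N}w_ix_i=1,$$ with the conventions $\infty\cdot 0=0$, $\infty^{1-\sigma}=0$, $0^{1-\sigma}=\infty$ and $c/\infty=0$ for all $c\in[0,\infty]$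 (so that $0<w_i<\infty$ in populated regions and $w_i=\infty$ in regions with $x_i=0$). The price index and the utility in region $i$ are $$P_i=\Bigl(\sum_{j\in N}a_j^{\sigma-1}w_j^{1-\sigma}\phi_{ji}\Bigr)^{\frac1{1-\sigma}},\qquad v_i=\frac{w_i}{P_i}.$$ A spatial equilibrium is a distribution $x\in X$ together with a market wage $w$ at $x$ for which there is a $v^*$ with $v_i=v^*$ for all $i$ with $x_i>0$ and $v_i\le v^*$ for all $i$ with $x_i=0$. Then a spatial equilibrium exists, and there is one in which the utilities $v_i$ are equal across all regions. Moreover, every spatial equilibrium $(x,w)$ satisfies $x_i>0$ for all $i\in N$. -/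

import Mathlib

open scoped ENNReal Matrix

noncomputable section

namespace ArmingtonEconomy

/-- Admissible externality matrices `ψ`: entries in `(0,1]`, unit diagonal, and the quadratic form
is positive on the nonzero vectors whose coordinates sum to zero. -/
structure IsExternalityMatrix {n : ℕ} (ψ : Matrix (Fin n) (Fin n) ℝ) : Prop where
  pos : ∀ i j, 0 < ψ i j
  le_one : ∀ i j, ψ i j ≤ 1
  diag : ∀ i, ψ i i = 1
  cond_pos_def : ∀ z : Fin n → ℝ, z ≠ 0 → ∑ i, z i = 0 → 0 < ∑ i, ∑ j, ψ i j * z i * z j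

/-- Admissible geographical proximity matrices `φ i j = τ i j ^ (1 - σ)`, where `1 < τ i j < ∞` for
`i ≠ j` and `τ i i = 1` are the iceberg transportation costs. -/
structure IsProximityMatrix {n : ℕ} (φ : Matrix (Fin n) (Fin n) ℝ) : Prop where
  off_diag_pos : ∀ i j, i ≠ j → 0 < φ i j
  off_diag_lt_one : ∀ i j, i ≠ j → φ i j < 1
  diag : ∀ i, φ i i = 1

/-- The productivity `a_i(x) = ∑ j, ψ i j * x j` of region `i`. -/
def productivity {n : ℕ} (ψ : Matrix (Fin n) (Fin n) ℝ) (x : Fin n → ℝ) (i : Fin n) : ℝ :=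
  ∑ j, ψ i j * x j

/-- The competitiveness `a_i ^ (σ - 1) * w_i ^ (1 - σ) * φ i j` (that is, `p_{ij} ^ (1 - σ)` for the
price `p_{ij} = w_i * τ i j / a_i`) of the good of region `i` in region `j`.
Wages take values in `[0, ∞]`, so that the wage of a region without workers may be infinite;
`∞ ^ (1 - σ) = 0` for `σ > 1`. -/
def competitiveness {n : ℕ} (σ : ℝ) (φ ψ : Matrix (Fin n) (Fin n) ℝ) (x : Fin n → ℝ)
    (w : Fin n → ℝ≥0∞) (i j : Fin n) : ℝ≥0∞ :=
  ENNReal.ofReal (productivity ψ x i) ^ (σ - 1) * w i ^ (1 - σ) * ENNReal.ofReal (φ i j)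

/-- The CES price index `P_j` of region `j`. -/
def priceIndex {n : ℕ} (σ : ℝ) (φ ψ : Matrix (Fin n) (Fin n) ℝ) (x : Fin n → ℝ)
    (w : Fin n → ℝ≥0∞) (j : Fin n) : ℝ≥0∞ :=
  (∑ i, competitiveness σ φ ψ x w i j) ^ (1 / (1 - σ))

/-- The total wage income `w_i * x_i` of region `i`, with `∞ * 0 = 0`. -/
def income {n : ℕ} (x : Fin n → ℝ) (w : Fin n → ℝ≥0∞) (i : Fin n) : ℝ≥0∞ :=
  w i * ENNReal.ofReal (x i)

/-- The value `Q_{ik}` of the goods shipped from region `i` to region `k`. -/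
def tradeValue {n : ℕ} (σ : ℝ) (φ ψ : Matrix (Fin n) (Fin n) ℝ) (x : Fin n → ℝ)
    (w : Fin n → ℝ≥0∞) (i k : Fin n) : ℝ≥0∞ :=
  competitiveness σ φ ψ x w i k / (∑ l, competitiveness σ φ ψ x w l k) * income x w k

/-- `w` is a market wage at the spatial distribution `x`: in every region income equals the value
of the goods sold in all regions, and total income is normalized to one. Under the
standing assumptions these equations force `0 < w i < ∞` where `x i > 0`, and `w i = ∞` where
`x i = 0`. -/
structure IsMarketWage {n : ℕ} (σ : ℝ) (φ ψ : Matrix (Fin n) (Fin n) ℝ) (x : Fin n → ℝ)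
    (w : Fin n → ℝ≥0∞) : Prop where
  clearing : ∀ i, income x w i = ∑ k, tradeValue σ φ ψ x w i k
  normalized : ∑ i, income x w i = 1

/-- The per capita indirect utility `v_i = w_i / P_i` in region `i`. -/
def utility {n : ℕ} (σ : ℝ) (φ ψ : Matrix (Fin n) (Fin n) ℝ) (x : Fin n → ℝ)
    (w : Fin n → ℝ≥0∞) (i : Fin n) : ℝ≥0∞ :=
  w i / priceIndex σ φ ψ x w i

/-- A spatial equilibrium: a distribution `x` of the unit mass of workers with a market wage `w`,
such that no worker has an incentive to move. -/
structure IsSpatialEquilibrium {n : ℕ} (σ : ℝ) (φ ψ : Matrix (Fin n) (Fin n) ℝ) (x : Fin n → ℝ)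
    (w : Fin n → ℝ≥0∞) : Prop where
  mem_simplex : x ∈ stdSimplex ℝ (Fin n)
  market : IsMarketWage σ φ ψ x w
  nash : ∃ v : ℝ≥0∞, (∀ i, 0 < x i → utility σ φ ψ x w i = v) ∧
    (∀ i, x i = 0 → utility σ φ ψ x w i ≤ v)

end ArmingtonEconomy

end

/-!
The main tool is Brouwer's fixed point theorem. Let `f` be a `C¹` map that fixes the boundary of a
ball and put `g = f - id`, extended by zero. For small `t` the map `id + t • g` is a bijection of
the ball with positive Jacobian, so the integral of `det (id + t • g')` is the volume of the ball;
being a polynomial in `t`, it equals that volume at `t = 1` too. But if `f` takes values in the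
sphere, `det f'` vanishes identically. Hence there is no such `f`; cutting off a bounded map turns
this into a fixed point, and uniform approximation removes the smoothness.

In an equilibrium with all regions populated, equality of the utilities makes `ω ^ (1 - σ)` a left
eigenvector of the matrix `a_i(x) ^ (σ - 1) * φ i k`, and market clearing then makes `ω ^ σ * x` a
right eigenvector for the same eigenvalue. Conversely `x` and `ω` can be recovered from two positive
vectors, and as the entries of the matrix stay between two positive bounds, normalizing its right
and left products with these vectors maps a compact part of a product of open simplices to itself.
The eigenvalues belonging to a fixed point agree since the two vectors are not orthogonal.

At a finite wage an unpopulated region would have sales but no income. So its wage is infinite while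
its price index is finite, and its infinite utility contradicts the equilibrium condition.
-/

section PolynomialDependence

open Polynomial MeasureTheory

theorem exists_polynomial_integral_eq_eval {α : Type*} [MeasurableSpace α] {μ : Measure α}
    {F : ℝ → α → ℝ} {d : ℕ}
    (hF : ∀ x, ∃ P : ℝ[X], P.natDegree ≤ d ∧ ∀ t, F t x = P.eval t)
    (hint : ∀ t, Integrable (F t) μ) :
    ∃ P : ℝ[X], ∀ t, ∫ x, F t x ∂μ = P.eval t := by
  let nodes := Finset.range (d + 1)
  have hnodes : Set.InjOn (Nat.cast : ℕ → ℝ) nodes := Nat.cast_injective.injOn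
  have interpolation (t : ℝ) (x : α) :
      F t x = ∑ k ∈ nodes, F k x * (Lagrange.basis nodes Nat.cast k).eval t := by
    obtain ⟨P, hdeg, hP⟩ := hF x
    have hdeg' : P.degree < nodes.card := by
      rw [Finset.card_range]
      exact degree_le_natDegree.trans_lt (by exact_mod_cast Nat.lt_succ_of_le hdeg)
    have := congrArg (eval t) (Lagrange.eq_interpolate hnodes hdeg')
    simpa only [Lagrange.interpolate_apply, eval_finsetSum, eval_mul, eval_C, ← hP] using this
  refine ⟨Lagrange.interpolate nodes Nat.cast fun k => ∫ x, F k x ∂μ, fun t => ?_⟩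
  simp only [interpolation t, Lagrange.interpolate_apply, eval_finsetSum, eval_mul, eval_C]
  rw [integral_finsetSum nodes fun (k : ℕ) _ => (hint k).mul_const _]
  simp only [integral_mul_const]

theorem exists_polynomial_det_add_smul {R M : Type*} [CommRing R] [Nontrivial R] [AddCommGroup M]
    [Module R M] [Module.Free R M] [Module.Finite R M] (A B : M →ₗ[R] M) :
    ∃ P : R[X], P.natDegree ≤ Module.finrank R M ∧
      ∀ t : R, LinearMap.det (A + t • B) = P.eval t := by
  let b := Module.finBasis R M
  refine ⟨_, (natDegree_det_X_add_C_le (LinearMap.toMatrix b b B) (LinearMap.toMatrix b b A)).trans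
    (Fintype.card_fin _).le, fun t => ?_⟩
  rw [← coe_evalRingHom, RingHom.map_det, ← LinearMap.det_toMatrix b]
  congr 1
  ext i j
  simp [add_comm, mul_comm t]

end PolynomialDependence

section Lipschitz

open Metric
open scoped NNReal

theorem bijective_id_add_of_contractingWith {E : Type*} [NormedAddCommGroup E] [CompleteSpace E]
    {K : ℝ≥0} {g : E → E} (hg : ContractingWith K g) : Function.Bijective fun x => x + g x := by
  have hsub (y : E) : ContractingWith K fun x => y - g x :=
    ⟨hg.1, LipschitzWith.of_dist_le_mul fun a b => by
      simpa only [dist_sub_left] using hg.2.dist_le_mul a b⟩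
  refine ⟨fun x x' h => ?_, fun y => ?_⟩
  · exact (hsub (x + g x)).fixedPoint_unique' (add_sub_cancel_right x (g x))
      (sub_eq_of_eq_add h)
  · exact ⟨_, eq_sub_iff_add_eq.1 (hsub y).fixedPoint_isFixedPt.symm⟩

theorem image_id_add_of_contractingWith {E : Type*} [NormedAddCommGroup E] [CompleteSpace E]
    {K : ℝ≥0} {g : E → E} {s : Set E} (hg : ContractingWith K g) (hgs : ∀ x ∉ s, g x = 0) :
    (fun x => x + g x) '' s = s := by
  have hbij := bijective_id_add_of_contractingWith hg
  have hcompl : (fun x => x + g x) '' sᶜ = sᶜ :=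
    (Set.image_congr fun x hx => by rw [hgs x hx, add_zero]; rfl).trans (Set.image_id sᶜ)
  rwa [Set.image_compl_eq hbij, compl_inj_iff] at hcompl

theorem exists_mem_segment_frontier {E : Type*} [AddCommGroup E] [Module ℝ E] [TopologicalSpace E]
    [IsTopologicalAddGroup E] [ContinuousSMul ℝ E] {s : Set E} (hs : IsOpen s) {x y : E}
    (hx : x ∈ s) (hy : y ∉ s) : ∃ z ∈ segment ℝ x y, z ∈ frontier s := by
  by_contra! hfr
  have hcover : segment ℝ x y ⊆ s ∪ (closure s)ᶜ := fun z hz => by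
    by_contra hzs
    rw [Set.mem_union, not_or, Set.notMem_compl_iff] at hzs
    exact hfr z hz (hs.frontier_eq ▸ ⟨hzs.2, hzs.1⟩)
  have hsub : segment ℝ x y ⊆ s := (convex_segment x y).isPreconnected.subset_left_of_subset_union
    hs isClosed_closure.isOpen_compl (disjoint_compl_right.mono_left subset_closure) hcover
    ⟨x, left_mem_segment ℝ x y, hx⟩
  exact hy (hsub (right_mem_segment ℝ x y))

theorem lipschitzWith_indicator_of_frontier {E F : Type*} [NormedAddCommGroup E] [NormedSpace ℝ E]
    [NormedAddCommGroup F] {C : ℝ≥0} {g : E → F} {s : Set E} (hs : IsOpen s)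
    (hg : LipschitzOnWith C g (closure s)) (hfr : ∀ x ∈ frontier s, g x = 0) :
    LipschitzWith C (s.indicator g) := by
  have across {x y : E} (hx : x ∈ s) (hy : y ∉ s) : dist (g x) 0 ≤ C * dist x y := by
    obtain ⟨z, hz, hzs⟩ := exists_mem_segment_frontier hs hx hy
    calc dist (g x) 0 = dist (g x) (g z) := by rw [hfr z hzs]
      _ ≤ C * dist x z := hg.dist_le_mul x (subset_closure hx) z (frontier_subset_closure hzs)
      _ ≤ C * dist x y := by
        gcongr
        linarith [dist_add_dist_of_mem_segment hz, dist_nonneg (x := z) (y := y)]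
  refine LipschitzWith.of_dist_le_mul fun x y => ?_
  by_cases hx : x ∈ s <;> by_cases hy : y ∈ s
  · simpa only [Set.indicator_of_mem, hx, hy] using
      hg.dist_le_mul x (subset_closure hx) y (subset_closure hy)
  · simpa only [Set.indicator_of_mem hx, Set.indicator_of_notMem hy] using across hx hy
  · simpa only [Set.indicator_of_notMem hx, Set.indicator_of_mem hy, dist_comm] using across hy hx
  · rw [Set.indicator_of_notMem hx, Set.indicator_of_notMem hy, dist_self]
    positivity

end Lipschitz

section Volume

open MeasureTheory Metric Filter Polynomial
open scoped NNReal Topology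

theorem eventually_det_id_add_pos {E : Type*} [NormedAddCommGroup E] [NormedSpace ℝ E] :
    ∀ᶠ A in 𝓝 (0 : E →L[ℝ] E), 0 < (ContinuousLinearMap.id ℝ E + A).det := by
  have hcont : Continuous fun A : E →L[ℝ] E => (ContinuousLinearMap.id ℝ E + A).det :=
    ContinuousLinearMap.continuous_det.comp (by fun_prop)
  exact hcont.continuousAt.eventually (lt_mem_nhds (by simp [ContinuousLinearMap.det]))

variable {E : Type*} [NormedAddCommGroup E] [NormedSpace ℝ E] [FiniteDimensional ℝ E]
  [MeasurableSpace E] [BorelSpace E] (μ : Measure E) [μ.IsAddHaarMeasure]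

theorem eventually_setIntegral_det_id_add_smul_eq_measureReal {C : ℝ≥0} {s : Set E}
    (hs : MeasurableSet s) {g : E → E} {g' : E → E →L[ℝ] E} (hg : LipschitzWith C g)
    (hgs : ∀ x ∉ s, g x = 0) (hg' : ∀ x ∈ s, HasFDerivAt g (g' x) x) :
    ∀ᶠ t : ℝ in 𝓝 0,
      ∫ x in s, (ContinuousLinearMap.id ℝ E + t • g' x).det ∂μ = μ.real s := by
  have hcontr : ∀ᶠ t : ℝ in 𝓝 0, ‖t‖₊ * C < 1 := by
    refine Continuous.continuousAt (by fun_prop) |>.eventually (gt_mem_nhds ?_)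
    simp
  obtain ⟨δ, hδ, hdet⟩ := Metric.eventually_nhds_iff.1 (eventually_det_id_add_pos (E := E))
  have hsmall : ∀ᶠ t : ℝ in 𝓝 0, ‖t‖ * C < δ := by
    refine Continuous.continuousAt (by fun_prop) |>.eventually (gt_mem_nhds ?_)
    simpa using hδ
  filter_upwards [hcontr, hsmall] with t ht htδ
  have hcontracting : ContractingWith (‖t‖₊ * C) fun x => t • g x :=
    ⟨ht, (lipschitzWith_smul t).comp hg⟩
  have himage := image_id_add_of_contractingWith hcontracting (s := s)
    fun x hx => by rw [hgs x hx, smul_zero]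
  have hderiv (x) (hx : x ∈ s) : HasFDerivWithinAt (fun x => x + t • g x)
      (ContinuousLinearMap.id ℝ E + t • g' x) s x :=
    ((hasFDerivAt_id x).add ((hg' x hx).const_smul t)).hasFDerivWithinAt
  have hpos (x) (hx : x ∈ s) : 0 < (ContinuousLinearMap.id ℝ E + t • g' x).det := by
    refine hdet ?_
    rw [dist_zero_right, norm_smul]
    refine lt_of_le_of_lt ?_ htδ
    gcongr
    exact (hg' x hx).le_of_lipschitz hg
  calc ∫ x in s, (ContinuousLinearMap.id ℝ E + t • g' x).det ∂μ
      = ∫ x in s, |(ContinuousLinearMap.id ℝ E + t • g' x).det| • (1 : ℝ) ∂μ :=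
        setIntegral_congr_fun hs fun x hx => by
          simp only [abs_of_pos (hpos x hx), smul_eq_mul, mul_one]
    _ = ∫ _ in (fun x => x + t • g x) '' s, (1 : ℝ) ∂μ :=
        (integral_image_eq_integral_abs_det_fderiv_smul μ hs hderiv
          (bijective_id_add_of_contractingWith hcontracting).injective.injOn fun _ => (1 : ℝ)).symm
    _ = μ.real s := by rw [himage, setIntegral_const, smul_eq_mul, mul_one]

theorem setIntegral_det_id_add_eq_measureReal {C : ℝ≥0} {s : Set E}
    (hs : MeasurableSet s) {g : E → E} {g' : E → E →L[ℝ] E} (hg : LipschitzWith C g)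
    (hgs : ∀ x ∉ s, g x = 0) (hg' : ∀ x ∈ s, HasFDerivAt g (g' x) x)
    (hint : ∀ t : ℝ, IntegrableOn (fun x => (ContinuousLinearMap.id ℝ E + t • g' x).det) s μ) :
    ∫ x in s, (ContinuousLinearMap.id ℝ E + g' x).det ∂μ = μ.real s := by
  obtain ⟨P, hP⟩ : ∃ P : ℝ[X], ∀ t : ℝ,
      ∫ x in s, (ContinuousLinearMap.id ℝ E + t • g' x).det ∂μ = P.eval t :=
    exists_polynomial_integral_eq_eval
      (fun x => exists_polynomial_det_add_smul (LinearMap.id : E →ₗ[ℝ] E) (g' x)) hint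
  have hconst : P = Polynomial.C (μ.real s) := by
    refine eq_of_infinite_eval_eq _ _ <| infinite_of_mem_nhds (0 : ℝ) ?_
    filter_upwards [eventually_setIntegral_det_id_add_smul_eq_measureReal μ hs hg hgs hg'] with t ht
    simpa only [eval_C, hP] using ht
  simpa [hconst] using hP 1

theorem setIntegral_det_fderiv_eq_measureReal {s : Set E} (hs : IsOpen s)
    (hsb : Bornology.IsBounded s) {f : E → E} (hf : ContDiff ℝ 1 f)
    (hfr : ∀ x ∈ frontier s, f x = x) :
    ∫ x in s, (fderiv ℝ f x).det ∂μ = μ.real s := by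
  have hcompact : IsCompact (closure s) := hsb.isCompact_closure
  have hg : ContDiff ℝ 1 fun x => f x - x := hf.sub contDiff_id
  obtain ⟨K, hK⟩ :=
    hg.locallyLipschitz.locallyLipschitzOn.exists_lipschitzOnWith_of_compact hcompact
  have hind : LipschitzWith K (s.indicator fun x => f x - x) :=
    lipschitzWith_indicator_of_frontier hs hK fun x hx => sub_eq_zero.2 (hfr x hx)
  have hderiv (x) (hx : x ∈ s) : HasFDerivAt (s.indicator fun x => f x - x)
      (fderiv ℝ f x - ContinuousLinearMap.id ℝ E) x :=
    (((hf.differentiable one_ne_zero x).hasFDerivAt.sub (hasFDerivAt_id x)).congr_of_eventuallyEq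
      ((Set.eqOn_indicator).eventuallyEq_of_mem (hs.mem_nhds hx)))
  have hcont (t : ℝ) : Continuous fun x => (ContinuousLinearMap.id ℝ E +
      t • (fderiv ℝ f x - ContinuousLinearMap.id ℝ E)).det := by
    have := hf.continuous_fderiv one_ne_zero
    exact ContinuousLinearMap.continuous_det.comp (by fun_prop)
  simpa only [add_sub_cancel] using setIntegral_det_id_add_eq_measureReal μ hs.measurableSet hind
    (fun x hx => Set.indicator_of_notMem hx _) hderiv fun t =>
      ((hcont t).continuousOn.integrableOn_compact hcompact).mono_set subset_closure

end Volume

section Brouwer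

open MeasureTheory Metric Filter
open scoped NNReal Topology RealInnerProductSpace

section InnerProductSpace

variable {E : Type*} [NormedAddCommGroup E] [InnerProductSpace ℝ E]

theorem det_eq_zero_of_norm_eventually_const [FiniteDimensional ℝ E] {f : E → E} {f' : E →L[ℝ] E}
    {x : E} {R : ℝ} (hR : R ≠ 0) (hf : ∀ᶠ y in 𝓝 x, ‖f y‖ = R) (hf' : HasFDerivAt f f' x) :
    f'.det = 0 := by
  have horth (v : E) : ⟪f x, f' v⟫ = 0 := by
    have hconst : (fun y => ‖f y‖ ^ 2) =ᶠ[𝓝 x] fun _ => R ^ 2 :=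
      hf.mono fun y hy => congrArg (· ^ 2) hy
    have := hf'.norm_sq.unique ((hasFDerivAt_const (R ^ 2) x).congr_of_eventuallyEq hconst)
    simpa using congr($this v)
  by_contra hdet
  obtain ⟨v, hv⟩ := (f'.toContinuousLinearEquivOfDetNeZero hdet).surjective (f x)
  have hfx : f' v = f x := hv
  have := horth v
  rw [hfx, inner_self_eq_zero, ← norm_eq_zero, hf.self_of_nhds] at this
  exact hR this

theorem exists_eq_zero_of_eq_id_on_sphere [FiniteDimensional ℝ E] {h : E → E} (hh : ContDiff ℝ 1 h)
    {R : ℝ} (hR : 0 < R) (hfix : ∀ x ∈ sphere (0 : E) R, h x = x) : ∃ x, h x = 0 := by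
  by_contra! hne
  borelize E
  let f : E → E := fun x => (R / ‖h x‖) • h x
  have hf : ContDiff ℝ 1 f :=
    (contDiff_const.div (hh.norm ℝ hne) fun x => norm_ne_zero_iff.2 (hne x)).smul hh
  have hnorm (x : E) : ‖f x‖ = R := by
    simp [f, norm_smul, abs_of_pos hR, hne x]
  have hfr (x) (hx : x ∈ frontier (ball (0 : E) R)) : f x = x := by
    have hx' := frontier_ball_subset_sphere hx
    simp [f, hfix x hx', mem_sphere_zero_iff_norm.1 hx', hR.ne']
  have hvol := setIntegral_det_fderiv_eq_measureReal (Measure.addHaar (G := E)) isOpen_ball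
    isBounded_ball hf hfr
  simp only [det_eq_zero_of_norm_eventually_const hR.ne' (.of_forall hnorm)
    (hf.differentiable one_ne_zero _).hasFDerivAt, integral_zero] at hvol
  exact (ENNReal.toReal_pos (measure_ball_pos _ 0 hR).ne' measure_ball_lt_top.ne).ne hvol

theorem exists_fixedPoint_of_contDiff_of_bounded [FiniteDimensional ℝ E] {f : E → E}
    (hf : ContDiff ℝ 1 f) {R : ℝ} (hR : ∀ x, ‖f x‖ ≤ R) : ∃ x, f x = x := by
  have hR0 : 0 ≤ R := (norm_nonneg _).trans (hR 0)
  let χ : ContDiffBump (0 : E) := ⟨R + 1, R + 2, by linarith, by linarith⟩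
  obtain ⟨x, hx⟩ : ∃ x, x - χ x • f x = 0 := by
    refine exists_eq_zero_of_eq_id_on_sphere (contDiff_id.sub (χ.contDiff.smul hf)) χ.rOut_pos
      fun x hx => ?_
    rw [χ.zero_of_le_dist (mem_sphere.1 hx).ge, zero_smul, sub_zero]
  rw [sub_eq_zero] at hx
  have hxR : ‖x‖ ≤ R := by
    rw [hx, norm_smul, Real.norm_of_nonneg χ.nonneg]
    exact (mul_le_of_le_one_left (norm_nonneg _) χ.le_one).trans (hR x)
  have hxχ : x ∈ closedBall 0 χ.rIn := mem_closedBall_zero_iff.2 (hxR.trans (by simp [χ]))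
  rw [χ.one_of_mem_closedBall hxχ, one_smul] at hx
  exact ⟨x, hx.symm⟩

theorem exists_fixedPoint_of_continuous_of_bounded [FiniteDimensional ℝ E] {f : E → E}
    (hf : Continuous f) {R : ℝ} (hR : ∀ x, ‖f x‖ ≤ R) : ∃ x, f x = x := by
  have hR0 : 0 ≤ R := (norm_nonneg _).trans (hR 0)
  obtain ⟨x₀, -, hmin⟩ := (isCompact_closedBall (0 : E) (R + 1)).exists_isMinOn
    (nonempty_closedBall.2 (by linarith)) (f := fun x => dist x (f x)) (by fun_prop)
  by_contra! hne
  let ε := min (dist x₀ (f x₀)) 1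
  have hε : 0 < ε := lt_min (dist_pos.2 (hne x₀).symm) one_pos
  obtain ⟨g, hg, hgf, -⟩ := hf.exists_contDiff_approx 1 continuous_const fun _ => hε
  have hgR (x : E) : ‖g x‖ ≤ R + 1 := by
    have := norm_le_norm_add_norm_sub' (g x) (f x)
    rw [← dist_eq_norm] at this
    linarith [hR x, hgf x, min_le_right (dist x₀ (f x₀)) 1]
  obtain ⟨x, hx⟩ := exists_fixedPoint_of_contDiff_of_bounded hg hgR
  have hle : dist x₀ (f x₀) ≤ dist x (f x) :=
    hmin (mem_closedBall_zero_iff.2 (hx ▸ hgR x))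
  have hlt : dist x (f x) < ε := by simpa only [hx] using hgf x
  exact (hle.trans_lt hlt).not_ge (min_le_left _ _)

theorem exists_retraction_of_convex {K : Set E} (hne : K.Nonempty) (hcomplete : IsComplete K)
    (hconv : Convex ℝ K) :
    ∃ r : E → E, LipschitzWith 1 r ∧ (∀ x, r x ∈ K) ∧ ∀ x ∈ K, r x = x := by
  choose r hrK hr using fun u => exists_norm_eq_iInf_of_complete_convex hne hcomplete hconv u
  have hangle (u : E) {w : E} (hw : w ∈ K) : ⟪u - r u, w - r u⟫ ≤ 0 :=
    (norm_eq_iInf_iff_real_inner_le_zero hconv (hrK u)).1 (hr u) w hw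
  refine ⟨r, LipschitzWith.of_dist_le_mul fun u v => ?_, hrK, fun x hx => ?_⟩
  · have hmono : ‖r u - r v‖ ^ 2 ≤ ⟪u - v, r u - r v⟫ := by
      have hu := hangle u (hrK v)
      have hv := hangle v (hrK u)
      rw [← real_inner_self_eq_norm_sq]
      simp only [inner_sub_left, inner_sub_right] at hu hv ⊢
      linarith
    have hcs := real_inner_le_norm (u - v) (r u - r v)
    rw [NNReal.coe_one, one_mul, dist_eq_norm, dist_eq_norm]
    nlinarith [norm_nonneg (u - v), norm_nonneg (r u - r v)]
  · have := hangle x hx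
    rwa [real_inner_self_nonpos, sub_eq_zero, eq_comm] at this

theorem exists_fixedPoint_of_convex_of_isCompact_inner [FiniteDimensional ℝ E] {K : Set E}
    (hne : K.Nonempty) (hcompact : IsCompact K) (hconv : Convex ℝ K) {f : E → E}
    (hf : ContinuousOn f K) (hmaps : Set.MapsTo f K K) : ∃ x ∈ K, f x = x := by
  obtain ⟨r, hr, hrK, hrfix⟩ := exists_retraction_of_convex hne hcompact.isComplete hconv
  obtain ⟨R, hR⟩ := hcompact.isBounded.exists_norm_le
  obtain ⟨x, hx⟩ := exists_fixedPoint_of_continuous_of_bounded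
    (hf.comp_continuous hr.continuous hrK) fun x => hR _ (hmaps (hrK x))
  have hxK : x ∈ K := hx ▸ hmaps (hrK x)
  exact ⟨x, hxK, by rwa [Function.comp_apply, hrfix x hxK] at hx⟩

end InnerProductSpace

theorem exists_fixedPoint_of_convex_of_isCompact {E : Type*} [NormedAddCommGroup E]
    [NormedSpace ℝ E] [FiniteDimensional ℝ E] {K : Set E} (hne : K.Nonempty)
    (hcompact : IsCompact K) (hconv : Convex ℝ K) {f : E → E} (hf : ContinuousOn f K)
    (hmaps : Set.MapsTo f K K) : ∃ x ∈ K, f x = x := by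
  let e : E ≃L[ℝ] EuclideanSpace ℝ (Fin (Module.finrank ℝ E)) := toEuclidean
  obtain ⟨-, ⟨x, hx, rfl⟩, hfix⟩ := exists_fixedPoint_of_convex_of_isCompact_inner
    (hne.image e) (hcompact.image e.continuous) (hconv.is_linear_image e.isLinear)
    (f := fun y => e (f (e.symm y)))
    (e.continuous.comp_continuousOn (hf.comp e.symm.continuous.continuousOn (by
      rintro - ⟨x, hx, rfl⟩
      rwa [e.symm_apply_apply])))
    (by
      rintro - ⟨x, hx, rfl⟩
      simpa only [e.symm_apply_apply] using Set.mem_image_of_mem e (hmaps hx))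
  exact ⟨x, hx, by simpa using hfix⟩

end Brouwer

section PositiveEigenvectors

variable {ι : Type*} [Fintype ι]

theorem exists_pos_forall_mem_Icc {κ : Type*} [Finite κ] [Nonempty κ] {f : κ → ℝ}
    (hf : ∀ k, 0 < f k) : ∃ m M : ℝ, 0 < m ∧ ∀ k, f k ∈ Set.Icc m M := by
  obtain ⟨p, hp⟩ := Finite.exists_min f
  obtain ⟨q, hq⟩ := Finite.exists_max f
  exact ⟨f p, f q, hf p, fun k => ⟨hp k, hq k⟩⟩

theorem dotProduct_mem_of_convex {s : Set ℝ} (hs : Convex ℝ s) {v y : ι → ℝ} (hv : ∀ i, v i ∈ s)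
    (hy : y ∈ stdSimplex ℝ ι) : v ⬝ᵥ y ∈ s := by
  rw [dotProduct_comm]
  exact hs.sum_mem (fun i _ => hy.1 i) hy.2 fun i _ => hv i

theorem eigenvalue_eq_of_dotProduct_ne_zero {R : Type*} [CommSemiring R]
    [IsCancelMulZero R] {A : Matrix ι ι R} {u y : ι → R} {l l' : R}
    (hy : A *ᵥ y = l • y) (hu : u ᵥ* A = l' • u) (huy : u ⬝ᵥ y ≠ 0) : l = l' := by
  refine mul_right_cancel₀ huy ?_
  calc l * (u ⬝ᵥ y) = u ⬝ᵥ (A *ᵥ y) := by rw [hy, dotProduct_smul, smul_eq_mul]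
    _ = (u ᵥ* A) ⬝ᵥ y := Matrix.dotProduct_mulVec u A y
    _ = l' * (u ⬝ᵥ y) := by rw [hu, smul_dotProduct, smul_eq_mul]

/-- The multiple of a vector whose coordinates sum to one; it is `0` if the coordinates of the
vector sum to zero. -/
noncomputable def sumNormalize (v : ι → ℝ) : ι → ℝ :=
  (∑ i, v i)⁻¹ • v

/-- The points of the standard simplex all of whose coordinates are positive. -/
def openSimplex (ι : Type*) [Fintype ι] : Set (ι → ℝ) :=
  {y ∈ stdSimplex ℝ ι | ∀ i, 0 < y i}

/-- The points of the standard simplex all of whose coordinates are at least `ε`. -/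
def truncatedSimplex (ι : Type*) [Fintype ι] (ε : ℝ) : Set (ι → ℝ) :=
  {y ∈ stdSimplex ℝ ι | ∀ i, ε ≤ y i}

theorem convex_truncatedSimplex (ε : ℝ) : Convex ℝ (truncatedSimplex ι ε) := by
  have : truncatedSimplex ι ε = stdSimplex ℝ ι ∩ Set.Ici fun _ => ε := rfl
  exact this ▸ (convex_stdSimplex ℝ ι).inter (convex_Ici _)

theorem isCompact_truncatedSimplex (ε : ℝ) : IsCompact (truncatedSimplex ι ε) := by
  have : truncatedSimplex ι ε = stdSimplex ℝ ι ∩ Set.Ici fun _ => ε := rfl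
  exact this ▸ (isCompact_stdSimplex ℝ ι).inter_right isClosed_Ici

theorem truncatedSimplex_subset_openSimplex {ε : ℝ} (hε : 0 < ε) :
    truncatedSimplex ι ε ⊆ openSimplex ι :=
  fun _ hy => ⟨hy.1, fun i => hε.trans_le (hy.2 i)⟩

theorem sum_smul_sumNormalize {v : ι → ℝ} (hsum : ∑ i, v i ≠ 0) :
    (∑ i, v i) • sumNormalize v = v :=
  smul_inv_smul₀ hsum v

theorem continuousOn_sumNormalize {X : Type*} [TopologicalSpace X] {s : Set X} {v : X → ι → ℝ}
    (hv : ContinuousOn v s) (hsum : ∀ x ∈ s, ∑ i, v x i ≠ 0) :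
    ContinuousOn (fun x => sumNormalize (v x)) s :=
  .smul (.inv₀ (continuousOn_finsetSum _ fun i _ => (continuous_apply i).comp_continuousOn hv) hsum)
    hv

variable [Nonempty ι]

theorem sumNormalize_mem_openSimplex {v : ι → ℝ} (hv : ∀ i, 0 < v i) :
    sumNormalize v ∈ openSimplex ι := by
  have hsum : 0 < ∑ i, v i := Finset.sum_pos (fun i _ => hv i) Finset.univ_nonempty
  have hpos (i) : 0 < sumNormalize v i := mul_pos (inv_pos.2 hsum) (hv i)
  refine ⟨⟨fun i => (hpos i).le, ?_⟩, hpos⟩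
  simp only [sumNormalize, Pi.smul_apply, smul_eq_mul, ← Finset.mul_sum]
  exact inv_mul_cancel₀ hsum.ne'

theorem openSimplex_nonempty : (openSimplex ι).Nonempty :=
  ⟨_, sumNormalize_mem_openSimplex (v := 1) fun _ => one_pos⟩

theorem sumNormalize_mem_truncatedSimplex {m M : ℝ} (hm : 0 < m) {v : ι → ℝ}
    (hv : ∀ i, v i ∈ Set.Icc m M) :
    sumNormalize v ∈ truncatedSimplex ι (m / (Fintype.card ι * M)) := by
  have hpos (i) : 0 < v i := hm.trans_le (hv i).1
  have hsum : 0 < ∑ i, v i := Finset.sum_pos (fun i _ => hpos i) Finset.univ_nonempty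
  refine ⟨(sumNormalize_mem_openSimplex hpos).1, fun i => ?_⟩
  have hle : ∑ i, v i ≤ Fintype.card ι * M := by
    simpa using Finset.sum_le_sum fun j (_ : j ∈ Finset.univ) => (hv j).2
  calc m / (Fintype.card ι * M) ≤ v i / ∑ i, v i := by
        gcongr
        exacts [(hpos i).le, (hv i).1]
    _ = sumNormalize v i := div_eq_inv_mul _ _

theorem exists_pos_smul_eq_pair {m M : ℝ} (hm : 0 < m) {F G : (ι → ℝ) × (ι → ℝ) → ι → ℝ}
    (hF : ContinuousOn F (openSimplex ι ×ˢ openSimplex ι))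
    (hG : ContinuousOn G (openSimplex ι ×ˢ openSimplex ι))
    (hFmem : ∀ p ∈ openSimplex ι ×ˢ openSimplex ι, ∀ i, F p i ∈ Set.Icc m M)
    (hGmem : ∀ p ∈ openSimplex ι ×ˢ openSimplex ι, ∀ i, G p i ∈ Set.Icc m M) :
    ∃ y ∈ openSimplex ι, ∃ u ∈ openSimplex ι, ∃ l l' : ℝ, 0 < l ∧ 0 < l' ∧
      F (y, u) = l • y ∧ G (y, u) = l' • u := by
  have hsum {v : ι → ℝ} (hv : ∀ i, v i ∈ Set.Icc m M) : 0 < ∑ i, v i :=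
    Finset.sum_pos (fun i _ => hm.trans_le (hv i).1) Finset.univ_nonempty
  obtain ⟨y₀, hy₀⟩ := openSimplex_nonempty (ι := ι)
  have hmem₀ := hFmem (y₀, y₀) ⟨hy₀, hy₀⟩
  have hM : 0 < M := (hm.trans_le (hmem₀ (Classical.arbitrary ι)).1).trans_le
    (hmem₀ (Classical.arbitrary ι)).2
  let ε := m / (Fintype.card ι * M)
  let K := truncatedSimplex ι ε ×ˢ truncatedSimplex ι ε
  have hε : 0 < ε := by positivity
  have hK : K ⊆ openSimplex ι ×ˢ openSimplex ι :=
    Set.prod_mono (truncatedSimplex_subset_openSimplex hε) (truncatedSimplex_subset_openSimplex hε)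
  have hne : (truncatedSimplex ι ε).Nonempty := ⟨_, sumNormalize_mem_truncatedSimplex hm hmem₀⟩
  obtain ⟨⟨y, u⟩, hyu, hfix⟩ := exists_fixedPoint_of_convex_of_isCompact (K := K) (hne.prod hne)
    ((isCompact_truncatedSimplex ε).prod (isCompact_truncatedSimplex ε))
    ((convex_truncatedSimplex ε).prod (convex_truncatedSimplex ε))
    (f := fun p => (sumNormalize (F p), sumNormalize (G p)))
    ((continuousOn_sumNormalize (hF.mono hK) fun p hp => (hsum (hFmem p (hK hp))).ne').prodMk
      (continuousOn_sumNormalize (hG.mono hK) fun p hp => (hsum (hGmem p (hK hp))).ne'))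
    (fun p hp => ⟨sumNormalize_mem_truncatedSimplex hm (hFmem p (hK hp)),
      sumNormalize_mem_truncatedSimplex hm (hGmem p (hK hp))⟩)
  obtain ⟨hfixy : sumNormalize (F (y, u)) = y, hfixu : sumNormalize (G (y, u)) = u⟩ :=
    Prod.ext_iff.1 hfix
  have hFpos := hsum (hFmem _ (hK hyu))
  have hGpos := hsum (hGmem _ (hK hyu))
  refine ⟨y, (hK hyu).1, u, (hK hyu).2, ∑ i, F (y, u) i, ∑ i, G (y, u) i,
    hFpos, hGpos, ?_, ?_⟩
  · simpa only [hfixy] using (sum_smul_sumNormalize hFpos.ne').symm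
  · simpa only [hfixu] using (sum_smul_sumNormalize hGpos.ne').symm

theorem exists_left_right_eigenvector {m M : ℝ} (hm : 0 < m)
    {A : (ι → ℝ) × (ι → ℝ) → Matrix ι ι ℝ}
    (hcont : ContinuousOn A (openSimplex ι ×ˢ openSimplex ι))
    (hA : ∀ p ∈ openSimplex ι ×ˢ openSimplex ι, ∀ i k, A p i k ∈ Set.Icc m M) :
    ∃ y ∈ openSimplex ι, ∃ u ∈ openSimplex ι, ∃ l : ℝ, 0 < l ∧
      A (y, u) *ᵥ y = l • y ∧ u ᵥ* A (y, u) = l • u := by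
  obtain ⟨y, hy, u, hu, l, l', hl, -, hyl, hul⟩ := exists_pos_smul_eq_pair hm
    (F := fun p => A p *ᵥ p.1) (G := fun p => p.2 ᵥ* A p)
    ((continuous_fst.matrix_mulVec continuous_snd).comp_continuousOn
      (hcont.prodMk continuousOn_fst))
    ((continuous_snd.matrix_vecMul continuous_fst).comp_continuousOn
      (hcont.prodMk continuousOn_snd))
    (fun p hp i => dotProduct_mem_of_convex (convex_Icc m M) (hA p hp i) hp.1.1)
    (fun p hp k => by
      rw [Matrix.vecMul, dotProduct_comm]
      exact dotProduct_mem_of_convex (convex_Icc m M) (fun i => hA p hp i k) hp.2.1)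
  have huy : 0 < u ⬝ᵥ y :=
    Finset.sum_pos (fun i _ => mul_pos (hu.2 i) (hy.2 i)) Finset.univ_nonempty
  rw [← eigenvalue_eq_of_dotProduct_ne_zero hyl hul huy.ne'] at hul
  exact ⟨y, hy, u, hu, l, hl, hyl, hul⟩

end PositiveEigenvectors

namespace ArmingtonEconomy

variable {n : ℕ} {σ : ℝ} {φ ψ : Matrix (Fin n) (Fin n) ℝ} {x : Fin n → ℝ}

theorem IsProximityMatrix.pos (hφ : IsProximityMatrix φ) (i j : Fin n) : 0 < φ i j := by
  rcases eq_or_ne i j with rfl | h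
  · exact hφ.diag i ▸ one_pos
  · exact hφ.off_diag_pos i j h

theorem productivity_mem_of_convex {s : Set ℝ} (hs : Convex ℝ s) (hψ : ∀ i j, ψ i j ∈ s)
    (hx : x ∈ stdSimplex ℝ (Fin n)) (i : Fin n) : productivity ψ x i ∈ s :=
  dotProduct_mem_of_convex hs (hψ i) hx

theorem productivity_pos (hψ : ∀ i j, 0 < ψ i j) (hx : x ∈ stdSimplex ℝ (Fin n)) (i : Fin n) :
    0 < productivity ψ x i :=
  productivity_mem_of_convex (convex_Ioi 0) hψ hx i

section PopulatedRegions

variable {w : Fin n → ℝ≥0∞} {i : Fin n}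

theorem ofReal_productivity_rpow_pos (ha : 0 < productivity ψ x i) :
    0 < ENNReal.ofReal (productivity ψ x i) ^ (σ - 1) :=
  ENNReal.rpow_pos (ENNReal.ofReal_pos.2 ha) ENNReal.ofReal_ne_top

theorem competitiveness_ne_zero (hσ : 1 < σ) (ha : 0 < productivity ψ x i) (hw : w i ≠ ∞)
    {j : Fin n} (hφ : 0 < φ i j) : competitiveness σ φ ψ x w i j ≠ 0 := by
  have hwage : w i ^ (1 - σ) ≠ 0 := by
    rw [← neg_sub, ENNReal.rpow_neg]
    exact ENNReal.inv_ne_zero.2 (ENNReal.rpow_ne_top_of_nonneg (by linarith) hw)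
  exact mul_ne_zero (mul_ne_zero (ofReal_productivity_rpow_pos ha).ne' hwage)
    (ENNReal.ofReal_pos.2 hφ).ne'

theorem sum_competitiveness_ne_zero (hσ : 1 < σ) (ha : 0 < productivity ψ x i) (hw : w i ≠ ∞)
    {k : Fin n} (hφ : 0 < φ i k) : ∑ l, competitiveness σ φ ψ x w l k ≠ 0 := fun hzero =>
  competitiveness_ne_zero hσ ha hw hφ (Finset.sum_eq_zero_iff.1 hzero i (Finset.mem_univ i))

theorem competitiveness_ne_top (hσ : 1 < σ) (hw : w i ≠ 0) (j : Fin n) :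
    competitiveness σ φ ψ x w i j ≠ ∞ := by
  have hwage : w i ^ (1 - σ) ≠ ∞ := by
    rw [← neg_sub, ENNReal.rpow_neg]
    exact ENNReal.inv_ne_top.2 (ENNReal.rpow_eq_zero_iff_of_pos (by linarith) |>.not.2 hw)
  exact ENNReal.mul_ne_top (ENNReal.mul_ne_top
    (ENNReal.rpow_ne_top_of_nonneg (by linarith) ENNReal.ofReal_ne_top) hwage) ENNReal.ofReal_ne_top

theorem competitiveness_eq_top (hσ : 1 < σ) (ha : 0 < productivity ψ x i) (hw : w i = 0)
    {j : Fin n} (hφ : 0 < φ i j) : competitiveness σ φ ψ x w i j = ∞ := by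
  rw [competitiveness, hw, ENNReal.zero_rpow_of_neg (by linarith),
    ENNReal.mul_top (ofReal_productivity_rpow_pos ha).ne',
    ENNReal.top_mul (ENNReal.ofReal_pos.2 hφ).ne']

theorem IsMarketWage.exists_income_ne_zero (h : IsMarketWage σ φ ψ x w) :
    ∃ k, income x w k ≠ 0 := by
  by_contra! hzero
  simpa [hzero] using h.normalized

theorem IsMarketWage.ne_top (h : IsMarketWage σ φ ψ x w) (hi : 0 < x i) : w i ≠ ∞ := by
  have hincome : income x w i ≠ ∞ :=
    ne_top_of_le_ne_top ENNReal.one_ne_top <|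
      h.normalized ▸ Finset.single_le_sum_of_canonicallyOrdered (Finset.mem_univ i)
  intro hw
  exact hincome (by rw [income, hw, ENNReal.top_mul (ENNReal.ofReal_pos.2 hi).ne'])

theorem IsMarketWage.ne_zero (hσ : 1 < σ) (hφ : ∀ j, 0 < φ i j) (ha : 0 < productivity ψ x i)
    (h : IsMarketWage σ φ ψ x w) : w i ≠ 0 := by
  intro hw
  have hsum (k) : ∑ l, competitiveness σ φ ψ x w l k = ∞ :=
    ENNReal.sum_eq_top.2 ⟨i, Finset.mem_univ i, competitiveness_eq_top hσ ha hw (hφ k)⟩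
  obtain ⟨j, hj⟩ := h.exists_income_ne_zero
  refine hj ?_
  rw [h.clearing]
  exact Finset.sum_eq_zero fun k _ => by rw [tradeValue, hsum, ENNReal.div_top, zero_mul]

variable (hσ : 1 < σ) (hφ : ∀ i j, 0 < φ i j) (ha : ∀ i, 0 < productivity ψ x i)

include hσ hφ ha

theorem IsMarketWage.sum_competitiveness_ne_top (h : IsMarketWage σ φ ψ x w) (k : Fin n) :
    ∑ l, competitiveness σ φ ψ x w l k ≠ ∞ :=
  ENNReal.sum_ne_top.2 fun l _ => competitiveness_ne_top hσ (h.ne_zero hσ (hφ l) (ha l)) k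

theorem IsMarketWage.eq_top_of_eq_zero (h : IsMarketWage σ φ ψ x w) (hi : x i = 0) :
    w i = ∞ := by
  by_contra hw
  obtain ⟨k, hk⟩ := h.exists_income_ne_zero
  have hsales : ∑ k, tradeValue σ φ ψ x w i k = 0 := by
    rw [← h.clearing, income, hi, ENNReal.ofReal_zero, mul_zero]
  have hsale := Finset.sum_eq_zero_iff.1 hsales k (Finset.mem_univ k)
  rw [tradeValue, mul_eq_zero, ENNReal.div_eq_zero_iff] at hsale
  rcases hsale with (hzero | htop) | hincome
  · exact competitiveness_ne_zero hσ (ha i) hw (hφ i k) hzero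
  · exact h.sum_competitiveness_ne_top hσ hφ ha k htop
  · exact hk hincome

theorem IsSpatialEquilibrium.pos (h : IsSpatialEquilibrium σ φ ψ x w) (i : Fin n) : 0 < x i := by
  refine (h.mem_simplex.1 i).lt_of_ne' fun hi => ?_
  obtain ⟨v, hpopulated, hempty⟩ := h.nash
  obtain ⟨j, -, hj⟩ : ∃ j ∈ Finset.univ, x j ≠ 0 :=
    Finset.exists_ne_zero_of_sum_ne_zero (h.mem_simplex.2 ▸ one_ne_zero)
  replace hj : 0 < x j := (h.mem_simplex.1 j).lt_of_ne' hj
  have hwj := h.market.ne_top hj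
  have hnum := h.market.sum_competitiveness_ne_top hσ hφ ha
  have hne (k) := sum_competitiveness_ne_zero hσ (ha j) hwj (hφ j k)
  have hi_top : utility σ φ ψ x w i = ∞ := by
    rw [utility, h.market.eq_top_of_eq_zero hσ hφ ha hi]
    exact ENNReal.top_div_of_ne_top (ENNReal.rpow_ne_top_of_ne_zero (hne i) (hnum i))
  have hj_ne_top : utility σ φ ψ x w j ≠ ∞ :=
    ENNReal.div_ne_top hwj (ENNReal.rpow_pos (pos_iff_ne_zero.2 (hne j)) (hnum j)).ne'
  refine hj_ne_top (top_le_iff.1 ?_)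
  rw [hpopulated j hj, ← hi_top]
  exact hempty i hi

end PopulatedRegions

section Existence

variable {ω : Fin n → ℝ} {l c : ℝ}

/-- The matrix `a_i(x) ^ (σ - 1) * φ i k`, the competitiveness of the goods at unit wages. -/
noncomputable def tradeMatrix (σ : ℝ) (φ ψ : Matrix (Fin n) (Fin n) ℝ) (x : Fin n → ℝ) :
    Matrix (Fin n) (Fin n) ℝ :=
  .of fun i k => productivity ψ x i ^ (σ - 1) * φ i k

/-- Positive real wages `ω` at which the eigenvector form of the market equations with equal
utilities holds: `ω ^ σ * x` is a right and `ω ^ (1 - σ)` a left eigenvector of the trade matrix,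
for the same positive eigenvalue `l`. Total income is not normalized. -/
structure IsBalancedWage (σ : ℝ) (φ ψ : Matrix (Fin n) (Fin n) ℝ) (x ω : Fin n → ℝ) (l : ℝ) :
    Prop where
  pos : ∀ i, 0 < ω i
  eigenvalue_pos : 0 < l
  mulVec : tradeMatrix σ φ ψ x *ᵥ (fun i => ω i ^ σ * x i) = l • fun i => ω i ^ σ * x i
  vecMul : (fun i => ω i ^ (1 - σ)) ᵥ* tradeMatrix σ φ ψ x = l • fun i => ω i ^ (1 - σ)

theorem tradeMatrix_nonneg (ha : ∀ i, 0 < productivity ψ x i) (hφ : ∀ i j, 0 < φ i j)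
    (i k : Fin n) : 0 ≤ tradeMatrix σ φ ψ x i k :=
  mul_nonneg (Real.rpow_nonneg (ha i).le _) (hφ i k).le

theorem competitiveness_ofReal {i : Fin n} (ha : 0 < productivity ψ x i) (hω : 0 < ω i)
    (k : Fin n) : competitiveness σ φ ψ x (fun i => ENNReal.ofReal (ω i)) i k =
      ENNReal.ofReal (ω i ^ (1 - σ) * tradeMatrix σ φ ψ x i k) := by
  have hapow : 0 ≤ productivity ψ x i ^ (σ - 1) := Real.rpow_nonneg ha.le _
  have hωpow : 0 ≤ ω i ^ (1 - σ) := Real.rpow_nonneg hω.le _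
  rw [competitiveness, ENNReal.ofReal_rpow_of_pos ha, ENNReal.ofReal_rpow_of_pos hω,
    ← ENNReal.ofReal_mul hapow, ← ENNReal.ofReal_mul (mul_nonneg hapow hωpow),
    tradeMatrix, Matrix.of_apply, mul_comm (_ ^ (σ - 1)), mul_assoc]

namespace IsBalancedWage

theorem smul (h : IsBalancedWage σ φ ψ x ω l) (hc : 0 < c) :
    IsBalancedWage σ φ ψ x (c • ω) l where
  pos i := mul_pos hc (h.pos i)
  eigenvalue_pos := h.eigenvalue_pos
  mulVec := by
    have hpow : (fun i => (c • ω) i ^ σ * x i) = c ^ σ • fun i => ω i ^ σ * x i := by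
      ext i
      simp only [Pi.smul_apply, smul_eq_mul, Real.mul_rpow hc.le (h.pos i).le, mul_assoc]
    rw [hpow, Matrix.mulVec_smul, h.mulVec, smul_comm]
  vecMul := by
    have hpow : (fun i => (c • ω) i ^ (1 - σ)) = c ^ (1 - σ) • fun i => ω i ^ (1 - σ) := by
      ext i
      simp only [Pi.smul_apply, smul_eq_mul, Real.mul_rpow hc.le (h.pos i).le]
    rw [hpow, Matrix.smul_vecMul, h.vecMul, smul_comm]

theorem sum_competitiveness (h : IsBalancedWage σ φ ψ x ω l) (hφ : ∀ i j, 0 < φ i j)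
    (ha : ∀ i, 0 < productivity ψ x i) (k : Fin n) :
    ∑ i, competitiveness σ φ ψ x (fun i => ENNReal.ofReal (ω i)) i k =
      ENNReal.ofReal (l * ω k ^ (1 - σ)) := by
  simp only [competitiveness_ofReal (ha _) (h.pos _)]
  rw [← ENNReal.ofReal_sum_of_nonneg fun i _ =>
    mul_nonneg (Real.rpow_nonneg (h.pos i).le _) (tradeMatrix_nonneg ha hφ i k)]
  exact congrArg ENNReal.ofReal (congrFun h.vecMul k)

theorem income_eq (h : IsBalancedWage σ φ ψ x ω l) (i : Fin n) :
    income x (fun i => ENNReal.ofReal (ω i)) i = ENNReal.ofReal (ω i * x i) :=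
  (ENNReal.ofReal_mul (h.pos i).le).symm

theorem tradeValue_eq (h : IsBalancedWage σ φ ψ x ω l) (hφ : ∀ i j, 0 < φ i j)
    (ha : ∀ i, 0 < productivity ψ x i) (i k : Fin n) :
    tradeValue σ φ ψ x (fun i => ENNReal.ofReal (ω i)) i k =
      ENNReal.ofReal (ω i ^ (1 - σ) / l * (tradeMatrix σ φ ψ x i k * (ω k ^ σ * x k))) := by
  have hl := h.eigenvalue_pos
  have hω := h.pos k
  have hnum : 0 ≤ ω i ^ (1 - σ) * tradeMatrix σ φ ψ x i k :=
    mul_nonneg (Real.rpow_nonneg (h.pos i).le _) (tradeMatrix_nonneg ha hφ i k)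
  have hden : 0 < l * ω k ^ (1 - σ) := mul_pos hl (Real.rpow_pos_of_pos hω _)
  have hωpow : ω k = ω k ^ (1 - σ) * ω k ^ σ := by
    rw [← Real.rpow_add hω, sub_add_cancel, Real.rpow_one]
  rw [tradeValue, h.sum_competitiveness hφ ha, h.income_eq, competitiveness_ofReal (ha i) (h.pos i),
    ← ENNReal.ofReal_div_of_pos hden, ← ENNReal.ofReal_mul (div_nonneg hnum hden.le)]
  congr 1
  nth_rewrite 2 [hωpow]
  have := (Real.rpow_pos_of_pos hω (1 - σ)).ne'
  field_simp

theorem isMarketWage (h : IsBalancedWage σ φ ψ x ω l) (hφ : ∀ i j, 0 < φ i j)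
    (ha : ∀ i, 0 < productivity ψ x i) (hx : ∀ i, 0 ≤ x i) (hnorm : ω ⬝ᵥ x = 1) :
    IsMarketWage σ φ ψ x (fun i => ENNReal.ofReal (ω i)) where
  clearing i := by
    have hmul : ∑ k, tradeMatrix σ φ ψ x i k * (ω k ^ σ * x k) = l * (ω i ^ σ * x i) :=
      congrFun h.mulVec i
    have hnonneg (k) :
        0 ≤ ω i ^ (1 - σ) / l * (tradeMatrix σ φ ψ x i k * (ω k ^ σ * x k)) :=
      mul_nonneg (div_nonneg (Real.rpow_nonneg (h.pos i).le _) h.eigenvalue_pos.le)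
        (mul_nonneg (tradeMatrix_nonneg ha hφ i k)
          (mul_nonneg (Real.rpow_nonneg (h.pos k).le _) (hx k)))
    simp only [h.income_eq, h.tradeValue_eq hφ ha]
    rw [← ENNReal.ofReal_sum_of_nonneg fun k _ => hnonneg k, ← Finset.mul_sum, hmul]
    congr 1
    calc ω i * x i = (ω i ^ (1 - σ) * ω i ^ σ) * x i := by
          rw [← Real.rpow_add (h.pos i), sub_add_cancel, Real.rpow_one]
      _ = ω i ^ (1 - σ) / l * (l * (ω i ^ σ * x i)) := by
          have := h.eigenvalue_pos.ne'
          field_simp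
  normalized := by
    simp only [h.income_eq]
    rw [← ENNReal.ofReal_sum_of_nonneg fun i _ => mul_nonneg (h.pos i).le (hx i),
      ← ENNReal.ofReal_one, ← hnorm, dotProduct]

theorem utility_eq (h : IsBalancedWage σ φ ψ x ω l) (hσ : σ ≠ 1) (hφ : ∀ i j, 0 < φ i j)
    (ha : ∀ i, 0 < productivity ψ x i) (i : Fin n) :
    utility σ φ ψ x (fun i => ENNReal.ofReal (ω i)) i =
      ENNReal.ofReal (l ^ (1 / (1 - σ)))⁻¹ := by
  have hω := h.pos i
  have hl := h.eigenvalue_pos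
  have hprice : (l * ω i ^ (1 - σ)) ^ (1 / (1 - σ)) = l ^ (1 / (1 - σ)) * ω i := by
    rw [Real.mul_rpow hl.le (Real.rpow_nonneg hω.le _), ← Real.rpow_mul hω.le,
      mul_one_div_cancel (sub_ne_zero.2 hσ.symm), Real.rpow_one]
  rw [utility, priceIndex, h.sum_competitiveness hφ ha,
    ENNReal.ofReal_rpow_of_pos (mul_pos hl (Real.rpow_pos_of_pos hω _)), hprice,
    ← ENNReal.ofReal_div_of_pos (mul_pos (Real.rpow_pos_of_pos hl _) hω),
    div_mul_cancel_right₀ hω.ne']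

theorem isSpatialEquilibrium (h : IsBalancedWage σ φ ψ x ω l) (hσ : σ ≠ 1)
    (hφ : ∀ i j, 0 < φ i j) (ha : ∀ i, 0 < productivity ψ x i) (hx : x ∈ stdSimplex ℝ (Fin n))
    (hnorm : ω ⬝ᵥ x = 1) : IsSpatialEquilibrium σ φ ψ x (fun i => ENNReal.ofReal (ω i)) where
  mem_simplex := hx
  market := h.isMarketWage hφ ha hx.1 hnorm
  nash := ⟨_, fun i _ => h.utility_eq hσ hφ ha i, fun i _ => (h.utility_eq hσ hφ ha i).le⟩

end IsBalancedWage

theorem continuous_tradeMatrix (hσ : 1 ≤ σ) : Continuous (tradeMatrix σ φ ψ) := by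
  refine continuous_matrix fun i k => .mul (.rpow_const ?_ fun _ => .inr (sub_nonneg.2 hσ))
    continuous_const
  exact continuous_finsetSum _ fun j _ => continuous_const.mul (continuous_apply j)

theorem exists_pos_forall_tradeMatrix_mem_Icc [Nonempty (Fin n)] (hσ : 1 ≤ σ)
    (hφ : ∀ i j, 0 < φ i j) (hψ : ∀ i j, 0 < ψ i j) :
    ∃ m M : ℝ, 0 < m ∧
      ∀ x ∈ stdSimplex ℝ (Fin n), ∀ i k, tradeMatrix σ φ ψ x i k ∈ Set.Icc m M := by
  obtain ⟨p, P, hp, hψmem⟩ := exists_pos_forall_mem_Icc fun p : Fin n × Fin n => hψ p.1 p.2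
  obtain ⟨q, Q, hq, hφmem⟩ := exists_pos_forall_mem_Icc fun p : Fin n × Fin n => hφ p.1 p.2
  have hs : 0 ≤ σ - 1 := sub_nonneg.2 hσ
  refine ⟨p ^ (σ - 1) * q, P ^ (σ - 1) * Q, by positivity, fun x hx i k => ?_⟩
  have ha := productivity_mem_of_convex (convex_Icc p P) (fun i j => hψmem (i, j)) hx i
  have ha₀ : 0 ≤ productivity ψ x i := hp.le.trans ha.1
  exact ⟨mul_le_mul (Real.rpow_le_rpow hp.le ha.1 hs) (hφmem (i, k)).1 hq.le
      (Real.rpow_nonneg ha₀ _),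
    mul_le_mul (Real.rpow_le_rpow ha₀ ha.2 hs) (hφmem (i, k)).2 (hφ i k).le
      (Real.rpow_nonneg (ha₀.trans ha.2) _)⟩

variable [Nonempty (Fin n)]

theorem exists_isBalancedWage (hσ : 1 < σ) (hφ : ∀ i j, 0 < φ i j) (hψ : ∀ i j, 0 < ψ i j) :
    ∃ x ∈ openSimplex (Fin n), ∃ ω l, IsBalancedWage σ φ ψ x ω l := by
  -- `y = ω ^ σ * x` and `u = ω ^ (1 - σ)` determine `ω` and, up to scaling, `x`, so the trade
  -- matrix becomes a function of `(y, u)`.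
  let wage (u : Fin n → ℝ) (i : Fin n) : ℝ := u i ^ (1 / (1 - σ))
  let workers (p : (Fin n → ℝ) × (Fin n → ℝ)) (i : Fin n) : ℝ := p.1 i * (wage p.2 i ^ σ)⁻¹
  let S := openSimplex (Fin n) ×ˢ openSimplex (Fin n)
  have hwage {u} (hu : u ∈ openSimplex (Fin n)) (i) : 0 < wage u i :=
    Real.rpow_pos_of_pos (hu.2 i) _
  have hworkers {p} (hp : p ∈ S) (i) : 0 < workers p i :=
    mul_pos (hp.1.2 i) (inv_pos.2 (Real.rpow_pos_of_pos (hwage hp.2 i) _))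
  have hsum {p} (hp : p ∈ S) : ∑ i, workers p i ≠ 0 :=
    (Finset.sum_pos (fun i _ => hworkers hp i) Finset.univ_nonempty).ne'
  have hcont : ContinuousOn workers S := by
    refine continuousOn_pi.2 fun i => .mul (by fun_prop) (.inv₀ (.rpow_const (.rpow_const
      (by fun_prop) fun p hp => .inl (hp.2.2 i).ne') fun p hp => .inl (hwage hp.2 i).ne') ?_)
    exact fun p hp => (Real.rpow_pos_of_pos (hwage hp.2 i) _).ne'
  obtain ⟨m, M, hm, hmem⟩ := exists_pos_forall_tradeMatrix_mem_Icc hσ.le hφ hψ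
  obtain ⟨y, hy, u, hu, l, hl, hyl, hul⟩ := exists_left_right_eigenvector hm
    (A := fun p => tradeMatrix σ φ ψ (sumNormalize (workers p)))
    ((continuous_tradeMatrix hσ.le).comp_continuousOn
      (continuousOn_sumNormalize hcont fun _ => hsum))
    (fun p hp => hmem _ (sumNormalize_mem_openSimplex (hworkers hp)).1)
  have hright : (fun i => wage u i ^ σ * sumNormalize (workers (y, u)) i) =
      (∑ i, workers (y, u) i)⁻¹ • y := by
    ext i
    have := (Real.rpow_pos_of_pos (hwage hu i) σ).ne'
    simp only [sumNormalize, workers, Pi.smul_apply, smul_eq_mul]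
    field_simp
  have hleft : (fun i => wage u i ^ (1 - σ)) = u := by
    ext i
    rw [← Real.rpow_mul (hu.2 i).le, one_div_mul_cancel (by linarith), Real.rpow_one]
  have hx := sumNormalize_mem_openSimplex (hworkers (p := (y, u)) ⟨hy, hu⟩)
  refine ⟨_, hx, wage u, l, hwage hu, hl, ?_, ?_⟩
  · rw [hright, Matrix.mulVec_smul, hyl, smul_comm]
  · rw [hleft, hul]

theorem exists_isSpatialEquilibrium (hσ : 1 < σ) (hφ : ∀ i j, 0 < φ i j)
    (hψ : ∀ i j, 0 < ψ i j) :
    ∃ (x : Fin n → ℝ) (w : Fin n → ℝ≥0∞), IsSpatialEquilibrium σ φ ψ x w ∧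
      ∀ i j, utility σ φ ψ x w i = utility σ φ ψ x w j := by
  obtain ⟨x, hx, ω, l, hω⟩ := exists_isBalancedWage hσ hφ hψ
  have ha := productivity_pos hψ hx.1
  have hincome : 0 < ω ⬝ᵥ x :=
    Finset.sum_pos (fun i _ => mul_pos (hω.pos i) (hx.2 i)) Finset.univ_nonempty
  have hnormalized := hω.smul (inv_pos.2 hincome)
  refine ⟨x, _, hnormalized.isSpatialEquilibrium hσ.ne' hφ ha hx.1 ?_, fun i j => ?_⟩
  · rw [smul_dotProduct, smul_eq_mul, inv_mul_cancel₀ hincome.ne']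
  · rw [hnormalized.utility_eq hσ.ne' hφ ha i, hnormalized.utility_eq hσ.ne' hφ ha j]

end Existence

end ArmingtonEconomy

open ArmingtonEconomy in
theorem mainTheorem5_general {n : ℕ} (hn : 1 ≤ n) {σ : ℝ} (hσ : 1 < σ)
    {φ ψ : Matrix (Fin n) (Fin n) ℝ} (hφ : ∀ i j, 0 < φ i j) (hψ : ∀ i j, 0 < ψ i j) :
    (∃ (x : Fin n → ℝ) (w : Fin n → ℝ≥0∞), IsSpatialEquilibrium σ φ ψ x w ∧
      ∀ i j, utility σ φ ψ x w i = utility σ φ ψ x w j) ∧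
    ∀ (x : Fin n → ℝ) (w : Fin n → ℝ≥0∞), IsSpatialEquilibrium σ φ ψ x w → ∀ i, 0 < x i :=
  have : Nonempty (Fin n) := ⟨⟨0, hn⟩⟩
  ⟨exists_isSpatialEquilibrium hσ hφ hψ,
    fun _ _ h => h.pos hσ hφ (productivity_pos hψ h.mem_simplex)⟩

theorem mainTheorem5 {n : ℕ} (hn : 1 ≤ n) (σ : ℝ) (hσ : 1 < σ)
    (φ ψ : Matrix (Fin n) (Fin n) ℝ)
    (hφ : ArmingtonEconomy.IsProximityMatrix φ) (hψ : ArmingtonEconomy.IsExternalityMatrix ψ) :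
    (∃ (x : Fin n → ℝ) (w : Fin n → ENNReal),
      ArmingtonEconomy.IsSpatialEquilibrium σ φ ψ x w ∧
      ∀ i j, ArmingtonEconomy.utility σ φ ψ x w i = ArmingtonEconomy.utility σ φ ψ x w j) ∧
    (∀ (x : Fin n → ℝ) (w : Fin n → ENNReal),
      ArmingtonEconomy.IsSpatialEquilibrium σ φ ψ x w → ∀ i, 0 < x i) :=
  mainTheorem5_general hn hσ hφ.pos hψ.pos
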